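/- Write $\log$ for the binary logarithm. Fix a universal machine $U$ that takes a binary program $p$ and an auxiliary input $y$ (the program $1^i0q$ runs the $i$-th partial recursive function on $\langle q,y\rangle$), and let $C(x\mid y)=\min\{|p| : U(p,y)=x\}$ be conditional Kolmogorov complexity. For a labeled graph $G$ on the nodes $1,\dots,n$, let $E(G)\in\{0,1\}^{n(n-1)/2}$ be the characteristic string of its edge set, with the possible edges $\{u,v\}$, $u<v$, in lexicographic order; $G$ is called $d$-random if $C(E(G)\mid n,d)\ge n(n-1)/2-d$. A port assignment of $G$ connects, at every node $u$, the edges incident to $u$ bijectively to ports labeled $1,\dots,\deg u$. A routing scheme stores at every node $u$ a binary string $F(u)$, the encoding of the local routing function of $u$; it is a program for $U$ which, given only the label of a destination $v\ne u$, returns the label of a port of $u$, over which a message for $v$ is then forwarded. In particular, neither the neighbours of $u$ nor the port assignment are known to $u$ for free. It is a shortest-path routing scheme if any two nodes $u,v$ are connected and the route that it produces from $u$ to $v$ has length $\operatorname{dist}_G(u,v)$. **Theorem.** Let $\delta:\mathbb N\to\mathbb N$ with $\delta(n)=O(\log n)$. There is a function $\varepsilon:\mathbb N\to\mathbb R$ with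 $\varepsilon(n)\to0$ as $n\to\infty$, depending only on $\delta$ (and $U$), such that for all sufficiently large $n$, every $\delta(n)$-random labeled graph $G$ on $n$ nodes and every port assignment of $G$ (neither the labels nor the port assignment may be changed), there is a shortest-path routing scheme $F$ for $G$ with $$|F(u)|\le \frac n2\log n\,(1+\varepsilon(n))\quad\text{for every node }u,\qquad\text{and hence}\qquad \sum_u |F(u)|\le\frac{n^2}2\log n\,(1+\varepsilon(n)).$$ -/

import Mathlib

open Filter Topology Asymptotics

namespace CompactRouting

/-- The reference universal machine, with a binary program `p` and an auxiliary input `y`.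
A program of the form `1^i 0 q` runs the `i`-th partial recursive function (in Mathlib's standard
enumeration of codes) on the input `⟨q, y⟩`; a program containing no `0` never halts. -/
def universalMachine (p : List Bool) (y : ℕ) : Part ℕ :=
  match p.dropWhile id with
  | [] => Part.none
  | _ :: q =>
      (Denumerable.ofNat Nat.Partrec.Code (p.takeWhile id).length).eval (Encodable.encode (q, y))

/-- The machine is universal: every partial recursive function of a program and an auxiliary input
is simulated by it, at the cost of a constant-length prefix. -/
theorem universalMachine_universal (f : List Bool × ℕ →. ℕ) (hf : Partrec f) :
    ∃ s : List Bool, ∀ (q : List Bool) (y : ℕ), universalMachine (s ++ q) y = f (q, y) := by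
  obtain ⟨c, hc⟩ := Nat.Partrec.Code.exists_code.1 hf
  refine ⟨List.replicate (Encodable.encode c) true ++ [false], fun q y => ?_⟩
  have h1 : ((List.replicate (Encodable.encode c) true ++ [false]) ++ q).dropWhile id
      = false :: q := by
    rw [List.append_assoc, List.dropWhile_append_of_pos (by simp)]
    simp
  have h2 : ((List.replicate (Encodable.encode c) true ++ [false]) ++ q).takeWhile id
      = List.replicate (Encodable.encode c) true := by
    rw [List.append_assoc, List.takeWhile_append_of_pos (by simp)]
    simp
  unfold universalMachine
  rw [h1, h2]
  simp only [Denumerable.ofNat_encode, List.length_replicate, hc, Encodable.encodek,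
    Part.coe_some, Part.bind_some]
  exact Part.map_id' (fun _ => rfl) _

/-- Conditional Kolmogorov complexity `C(x | y)`: the length of a shortest program that makes
the universal machine print the string `x` when it is given `y`. -/
noncomputable def condComplexity (x : List Bool) (y : ℕ) : ℕ :=
  sInf {k | ∃ p : List Bool, p.length = k ∧ Encodable.encode x ∈ universalMachine p y}

/-- The minimum in the definition of `condComplexity` is attained. -/
theorem exists_program (x : List Bool) (y : ℕ) :
    ∃ p : List Bool, p.length = condComplexity x y ∧
      Encodable.encode x ∈ universalMachine p y := by
  obtain ⟨s, hs⟩ := universalMachine_universal (fun _ => Part.some (Encodable.encode x))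
    (Computable.const (Encodable.encode x)).partrec
  exact Nat.sInf_mem (s := {k | ∃ p : List Bool, p.length = k ∧
      Encodable.encode x ∈ universalMachine p y})
    ⟨_, s ++ [], rfl, by rw [hs]; exact Part.mem_some _⟩

open Classical in
/-- The standard encoding `E(G)` of a labeled graph on `n` nodes: the characteristic string of the
edge set, with the `n (n - 1) / 2` possible edges `{u, v}`, `u < v`, in lexicographic order. -/
noncomputable def graphCode {n : ℕ} (G : SimpleGraph (Fin n)) : List Bool :=
  (List.finRange n).flatMap fun u =>
    ((List.finRange n).filter fun v => u < v).map fun v => decide (G.Adj u v)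

/-- A labeled graph on `n` nodes is `d`-random (has randomness deficiency at most `d`) in the family
of all labeled graphs on `n` nodes: `C(E(G) | n, d) ≥ n (n - 1) / 2 - d`. -/
def IsRandomGraph {n : ℕ} (d : ℕ) (G : SimpleGraph (Fin n)) : Prop :=
  n * (n - 1) / 2 ≤ condComplexity (graphCode G) (Nat.pair n d) + d

/-- The label in `{1, …, n}` of a node. -/
def nodeLabel {n : ℕ} (v : Fin n) : ℕ := (v : ℕ) + 1

/-- A port assignment: at every node `u`, the incident edges (that is, the neighbours of `u`) are
connected bijectively to `deg u` ports. -/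
abbrev PortAssignment {n : ℕ} (G : SimpleGraph (Fin n)) : Type :=
  ∀ u : Fin n, G.neighborSet u ≃ Fin (Nat.card (G.neighborSet u))

/-- The label in `{1, …, deg u}` of the port of `u` that leads to its neighbour `w`. -/
def portLabel {n : ℕ} {G : SimpleGraph (Fin n)} (π : PortAssignment G) (u : Fin n)
    (w : G.neighborSet u) : ℕ := (π u w : ℕ) + 1

/-- A routing scheme stores a binary string `F u` at every node `u`, as the encoding of the local
routing function of `u`. This is a program that receives nothing but the label of the destination
`v` and returns the label of a port of `u`. `Forwards π F v u w` says that the local routing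
function at `u` sends a message for `v` over the edge from `u` to its neighbour `w`. -/
def Forwards {n : ℕ} {G : SimpleGraph (Fin n)} (π : PortAssignment G) (F : Fin n → List Bool)
    (v u w : Fin n) : Prop :=
  ∃ h : w ∈ G.neighborSet u, portLabel π u ⟨w, h⟩ ∈ universalMachine (F u) (nodeLabel v)

/-- `Route π F v u k`: the route that the scheme `F` produces from `u` reaches the destination `v`
after traversing exactly `k` edges. -/
inductive Route {n : ℕ} {G : SimpleGraph (Fin n)} (π : PortAssignment G)
    (F : Fin n → List Bool) (v : Fin n) : Fin n → ℕ → Prop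
  | arrived : Route π F v v 0
  | step {u w : Fin n} {k : ℕ} : u ≠ v → Forwards π F v u w → Route π F v w k →
      Route π F v u (k + 1)

/-- The scheme `F` is a shortest-path routing scheme for `G` with port assignment `π`: between any
two nodes it produces a route, and this route is a shortest path. -/
def IsShortestPathRouting {n : ℕ} {G : SimpleGraph (Fin n)} (π : PortAssignment G)
    (F : Fin n → List Bool) : Prop :=
  ∀ u v : Fin n, G.Reachable u v ∧ Route π F v u (G.dist u v)

end CompactRouting

namespace CompactRouting

/-- The number with the given binary digits, least significant digit first. -/
def bitsVal (l : List Bool) : ℕ := l.foldr (fun b a => 2 * a + cond b 1 0) 0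

theorem exists_bits (k : ℕ) : ∀ a < 2 ^ k, ∃ l : List Bool, l.length = k ∧ bitsVal l = a := by
  induction k with
  | zero => intro a ha; exact ⟨[], rfl, by simp [bitsVal]; omega⟩
  | succ k ih =>
    intro a ha
    obtain ⟨l, hl, hv⟩ := ih (a / 2) (by rw [pow_succ] at ha; omega)
    refine ⟨decide (a % 2 = 1) :: l, by simp [hl], ?_⟩
    have : bitsVal (decide (a % 2 = 1) :: l) = 2 * bitsVal l + cond (decide (a % 2 = 1)) 1 0 := rfl
    rw [this, hv]
    by_cases h : a % 2 = 1 <;> simp [h] <;> omega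

theorem primrec_bitsVal : Primrec bitsVal := by
  refine Primrec.list_foldr (h := fun _ z => 2 * z.2 + cond z.1 1 0) Primrec.id
    (Primrec.const 0) (Primrec₂.mk ?_)
  refine Primrec.nat_add.comp (Primrec.nat_mul.comp (Primrec.const 2)
    (Primrec.snd.comp Primrec.snd)) ?_
  exact Primrec.cond (Primrec.fst.comp Primrec.snd) (Primrec.const 1) (Primrec.const 0)

theorem primrec_filter {α β : Type*} [Primcodable α] [Primcodable β] {f : α → List β}
    {p : α → β → Bool} (hf : Primrec f) (hp : Primrec₂ p) :
    Primrec fun a => (f a).filter (p a) := by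
  have h : Primrec fun a => (f a).filterMap fun b => cond (p a b) (some b) none :=
    Primrec.listFilterMap hf
      (Primrec.cond hp (Primrec.option_some.comp Primrec.snd) (Primrec.const none)).to₂
  refine h.of_eq fun a => ?_
  rw [← List.filterMap_eq_filter]
  congr 1
  funext b
  cases hb : p a b <;> simp [hb, Option.guard]

theorem primrec_any {α β : Type*} [Primcodable α] [Primcodable β] {f : α → List β}
    {p : α → β → Bool} (hf : Primrec f) (hp : Primrec₂ p) :
    Primrec fun a => (f a).any (p a) := by
  have h : Primrec fun a => !decide (((f a).filter (p a)).length = 0) :=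
    Primrec.not.comp (Primrec.eq.decide.comp
      (Primrec.list_length.comp (primrec_filter hf hp)) (Primrec.const 0))
  refine h.of_eq fun a => ?_
  rw [Bool.eq_iff_iff]
  simp

theorem primrec_pow : Primrec₂ fun a b : ℕ => a ^ b :=
  (Primrec₂.unpaired'.1 Nat.Primrec.pow)

theorem primrec_log : Primrec (Nat.log 2) := by
  have h : Primrec fun n : ℕ => n.findGreatest fun k => 2 ^ k ≤ n :=
    Primrec.nat_findGreatest (p := fun n k => 2 ^ k ≤ n) Primrec.id
      (Primrec.nat_le.comp (primrec_pow.comp (Primrec.const 2) Primrec.snd) Primrec.fst)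
  refine h.of_eq fun n => ?_
  rcases Nat.eq_zero_or_pos n with rfl | hn
  · simp
  · apply le_antisymm
    · apply Nat.le_log_of_pow_le (by norm_num)
      rcases Nat.eq_zero_or_pos (n.findGreatest fun k => 2 ^ k ≤ n) with h0 | h0
      · rw [h0]; exact hn
      · exact Nat.findGreatest_of_ne_zero (P := fun k => 2 ^ k ≤ n) rfl h0.ne'
    · exact Nat.le_findGreatest (Nat.log_le_self 2 n) (Nat.pow_log_le_self 2 hn.ne')

/-- A member of a computable finite list of at most `2 ^ r` strings has complexity at most
`r + O(1)`. -/
theorem exists_condComplexity_le {g : ℕ → List (List Bool)} (hg : Primrec g) :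
    ∃ c : ℕ, ∀ y r : ℕ, (g y).length ≤ 2 ^ r → ∀ x ∈ g y, condComplexity x y ≤ r + c := by
  have hp : Primrec fun z : List Bool × ℕ => Encodable.encode ((g z.2).getI (bitsVal z.1)) :=
    Primrec.encode.comp (Primrec.list_getI.comp (hg.comp Primrec.snd)
      (primrec_bitsVal.comp Primrec.fst))
  obtain ⟨s, hs⟩ := universalMachine_universal _ hp.to_comp.partrec
  refine ⟨s.length, fun y r hr x hx => ?_⟩
  obtain ⟨i, hi, rfl⟩ := List.mem_iff_getElem.1 hx
  obtain ⟨q, hq, hv⟩ := exists_bits r i (hi.trans_le hr)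
  refine Nat.sInf_le ⟨s ++ q, by simp [hq, add_comm], ?_⟩
  rw [hs]
  simp [hv, List.getI_eq_getElem _ hi]

/-- All bit strings of length `k`. -/
def bitStrings (k : ℕ) : List (List Bool) :=
  Nat.rec [[]] (fun _ l => l.flatMap fun x => [false :: x, true :: x]) k

theorem primrec_bitStrings : Primrec bitStrings := by
  have h : Primrec fun l : List (List Bool) => l.flatMap fun x => [false :: x, true :: x] := by
    refine Primrec.list_flatMap Primrec.id (Primrec₂.mk ?_)
    refine Primrec.list_cons.comp (Primrec.list_cons.comp (Primrec.const false) Primrec.snd) ?_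
    exact Primrec.list_cons.comp (Primrec.list_cons.comp (Primrec.const true) Primrec.snd)
      (Primrec.const [])
  exact Primrec.nat_rec₁ _ (h.comp Primrec.snd).to₂

theorem mem_bitStrings (k : ℕ) : ∀ x : List Bool, x ∈ bitStrings k ↔ x.length = k := by
  induction k with
  | zero => intro x; simp [bitStrings]
  | succ k ih =>
    intro x
    have h : bitStrings (k + 1)
        = (bitStrings k).flatMap fun x => [false :: x, true :: x] := rfl
    rw [h, List.mem_flatMap]
    rcases x with _ | ⟨b, x⟩
    · simp
    · cases b <;> simp [ih]

theorem nodup_bitStrings (k : ℕ) : (bitStrings k).Nodup := by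
  induction k with
  | zero => simp [bitStrings]
  | succ k ih =>
    have h : bitStrings (k + 1)
        = (bitStrings k).flatMap fun x => [false :: x, true :: x] := rfl
    rw [h, List.nodup_flatMap]
    refine ⟨fun x _ => by simp, ih.imp ?_⟩
    intro a b hab
    simp [Function.onFun, hab.symm]

/-- A computable family of sets of bit strings of length `k y`, with at most `2 ^ r` members. -/
theorem exists_condComplexity_le_of_card {k : ℕ → ℕ} (hk : Primrec k)
    {p : ℕ → List Bool → Bool} (hp : Primrec₂ p) :
    ∃ c : ℕ, ∀ y r : ℕ,
      (Finset.univ.filter fun f : Fin (k y) → Bool => p y (List.ofFn f)).card ≤ 2 ^ r →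
      ∀ x : List Bool, x.length = k y → p y x → condComplexity x y ≤ r + c := by
  obtain ⟨c, hc⟩ := exists_condComplexity_le
    (primrec_filter (primrec_bitStrings.comp hk) hp)
  refine ⟨c, fun y r hr x hx hpx => hc y r (le_trans ?_ hr) x ?_⟩
  · rw [← List.toFinset_card_of_nodup ((nodup_bitStrings _).filter _)]
    refine Finset.card_le_card_of_surjOn List.ofFn ?_
    intro x hx
    simp only [List.coe_toFinset, List.mem_filter, mem_bitStrings, Set.mem_ofPred_eq] at hx
    obtain ⟨hx, hpx⟩ := hx
    refine ⟨fun i => x.get (i.cast hx.symm), ?_, ?_⟩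
    all_goals
      have : List.ofFn (fun i => x.get (Fin.cast hx.symm i)) = x := by
        apply List.ext_getElem <;> simp [hx]
    · simp only [Finset.coe_filter, Finset.mem_univ, true_and, Set.mem_ofPred_eq]
      rwa [this]
    · exact this
  · simp [mem_bitStrings, hx, hpx]

/-- The possible edges `(u, v)`, `u < v`, of a graph on `0, …, n - 1`, in lexicographic order. -/
def pairs (n : ℕ) : List (ℕ × ℕ) :=
  (List.range n).flatMap fun u => ((List.range n).filter fun v => u < v).map fun v => (u, v)

/-- Position of the edge `{u, v}` in the characteristic string of a graph on `n` nodes. -/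
def edgePos (n u v : ℕ) : ℕ := (pairs n).idxOf (min u v, max u v)

/-- Adjacency of `u` and `v` in the graph on `n` nodes with characteristic string `x`. -/
def codeAdj (n : ℕ) (x : List Bool) (u v : ℕ) : Bool := x.getD (edgePos n u v) false

/-- The degree of `u` exceeds `n / 2 + n / (2 log n)`. -/
def highDegree (n : ℕ) (x : List Bool) (u : ℕ) : Bool :=
  decide (n * Nat.log 2 n + n < Nat.log 2 n * (2 * ((List.range n).filter (codeAdj n x u)).length))

/-- `u` and `v` have no common neighbour among the first `(log n) ^ 2` nodes. -/
def noCommonNeighbour (n : ℕ) (x : List Bool) (u v : ℕ) : Bool :=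
  !decide (u = v) &&
    !((List.range (Nat.log 2 n ^ 2)).any fun w => codeAdj n x u w && codeAdj n x v w)

/-- The graph with characteristic string `x` has a node of high degree, or two nodes without a
common neighbour among the first nodes. -/
def atypical (n : ℕ) (x : List Bool) : Bool :=
  ((List.range n).any fun u => highDegree n x u) ||
    (List.range n).any fun u => (List.range n).any fun v => noCommonNeighbour n x u v

theorem primrec_pairs : Primrec pairs := by
  refine Primrec.list_flatMap Primrec.list_range (Primrec₂.mk ?_)
  refine Primrec.list_map (primrec_filter (Primrec.list_range.comp Primrec.fst) (Primrec₂.mk ?_))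
    (Primrec₂.mk ?_)
  · exact Primrec.nat_lt.decide.comp (Primrec.snd.comp Primrec.fst) Primrec.snd
  · exact Primrec.pair (Primrec.snd.comp Primrec.fst) Primrec.snd

theorem primrec_codeAdj {α : Type*} [Primcodable α] {n u v : α → ℕ} {x : α → List Bool}
    (hn : Primrec n) (hx : Primrec x) (hu : Primrec u) (hv : Primrec v) :
    Primrec fun a => codeAdj (n a) (x a) (u a) (v a) := by
  refine (Primrec.list_getD false).comp hx ?_
  have h := Primrec.list_idxOf.comp
    ((Primrec.nat_min.comp hu hv).pair (Primrec.nat_max.comp hu hv)) (primrec_pairs.comp hn)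
  refine h.of_eq fun a => ?_
  unfold edgePos
  congr 1
  exact lawful_beq_subsingleton _ _

theorem primrec_highDegree {α : Type*} [Primcodable α] {n u : α → ℕ} {x : α → List Bool}
    (hn : Primrec n) (hx : Primrec x) (hu : Primrec u) :
    Primrec fun a => highDegree (n a) (x a) (u a) := by
  have hL := primrec_log.comp hn
  refine Primrec.nat_lt.decide.comp (Primrec.nat_add.comp (Primrec.nat_mul.comp hn hL) hn)
    (Primrec.nat_mul.comp hL (Primrec.nat_mul.comp (Primrec.const 2) (Primrec.list_length.comp
      (primrec_filter (Primrec.list_range.comp hn) (Primrec₂.mk ?_)))))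
  exact primrec_codeAdj (hn.comp Primrec.fst) (hx.comp Primrec.fst) (hu.comp Primrec.fst)
    Primrec.snd

theorem primrec_noCommonNeighbour {α : Type*} [Primcodable α] {n u v : α → ℕ}
    {x : α → List Bool} (hn : Primrec n) (hx : Primrec x) (hu : Primrec u) (hv : Primrec v) :
    Primrec fun a => noCommonNeighbour (n a) (x a) (u a) (v a) := by
  have hL := primrec_log.comp hn
  refine Primrec.and.comp (Primrec.not.comp (Primrec.eq.decide.comp hu hv))
    (Primrec.not.comp (primrec_any (Primrec.list_range.comp
      (primrec_pow.comp hL (Primrec.const 2))) (Primrec₂.mk ?_)))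
  exact Primrec.and.comp
    (primrec_codeAdj (hn.comp Primrec.fst) (hx.comp Primrec.fst) (hu.comp Primrec.fst) Primrec.snd)
    (primrec_codeAdj (hn.comp Primrec.fst) (hx.comp Primrec.fst) (hv.comp Primrec.fst) Primrec.snd)

theorem primrec_atypical : Primrec₂ atypical := by
  have hr := Primrec.list_range
  refine Primrec.or.comp (primrec_any (hr.comp Primrec.fst) (Primrec₂.mk ?_))
    (primrec_any (hr.comp Primrec.fst) (Primrec₂.mk
      (primrec_any (hr.comp (Primrec.fst.comp Primrec.fst)) (Primrec₂.mk ?_))))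
  · exact primrec_highDegree (Primrec.fst.comp Primrec.fst) (Primrec.snd.comp Primrec.fst)
      Primrec.snd
  · have h := Primrec.fst.comp (Primrec.fst (α := (ℕ × List Bool) × ℕ) (β := ℕ))
    exact primrec_noCommonNeighbour (Primrec.fst.comp h) (Primrec.snd.comp h)
      (Primrec.snd.comp Primrec.fst) Primrec.snd

/-- A graph whose code is atypical has complexity at most the logarithm of the number of atypical
codes. -/
theorem exists_condComplexity_atypical_le :
    ∃ c : ℕ, ∀ n d r : ℕ,
      (Finset.univ.filter fun f : Fin (pairs n).length → Bool =>
        atypical n (List.ofFn f)).card ≤ 2 ^ r →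
      ∀ x : List Bool, x.length = (pairs n).length → atypical n x →
        condComplexity x (Nat.pair n d) ≤ r + c := by
  have hn : Primrec fun y : ℕ => y.unpair.1 := Primrec.fst.comp Primrec.unpair
  obtain ⟨c, hc⟩ := exists_condComplexity_le_of_card
    (Primrec.list_length.comp (primrec_pairs.comp hn))
    (p := fun y x => atypical y.unpair.1 x)
    (Primrec₂.mk (primrec_atypical.comp (hn.comp Primrec.fst) Primrec.snd))
  refine ⟨c, fun n d r => ?_⟩
  obtain ⟨y, rfl, hy⟩ : ∃ y : ℕ, y.unpair.1 = n ∧ Nat.pair n d = y :=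
    ⟨Nat.pair n d, by rw [Nat.unpair_pair], rfl⟩
  rw [hy]
  exact hc y r

theorem mem_pairs {n a b : ℕ} : (a, b) ∈ pairs n ↔ a < b ∧ b < n := by
  simp only [pairs, List.mem_flatMap, List.mem_range, List.mem_map, List.mem_filter,
    decide_eq_true_eq, Prod.mk.injEq]
  constructor
  · rintro ⟨u, hu, v, ⟨hv, huv⟩, rfl, rfl⟩
    exact ⟨huv, hv⟩
  · rintro ⟨h1, h2⟩
    exact ⟨a, by omega, b, ⟨h2, h1⟩, rfl, rfl⟩

theorem length_pairs (n : ℕ) : (pairs n).length = n * (n - 1) / 2 := by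
  have h : ∀ u ∈ List.range n,
      (((List.range n).filter fun v => u < v).map fun v => (u, v)).length = n - 1 - u := by
    intro u hu
    rw [List.length_map, ← List.toFinset_card_of_nodup (List.nodup_range.filter _)]
    have : ((List.range n).filter fun v => u < v).toFinset = Finset.Ioo u n := by
      ext v; simp [and_comm]
    rw [this, Nat.card_Ioo]
    omega
  rw [pairs, List.length_flatMap, List.map_congr_left h, ← Finset.sum_range_id,
    ← Finset.sum_range_reflect]
  rfl

theorem edgePos_lt {n u v : ℕ} (hu : u < n) (hv : v < n) (h : u ≠ v) :
    edgePos n u v < (pairs n).length := by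
  rw [edgePos, List.idxOf_lt_length_iff, mem_pairs]
  omega

theorem edgePos_inj {n u v u' v' : ℕ} (hu : u < n) (hv : v < n) (h : u ≠ v)
    (he : edgePos n u v = edgePos n u' v') : (u = u' ∧ v = v') ∨ (u = v' ∧ v = u') := by
  have hm : (min u v, max u v) ∈ pairs n := by rw [mem_pairs]; omega
  have := (List.idxOf_inj hm).1 he
  rw [Prod.mk.injEq] at this
  omega

theorem codeAdj_ofFn {n u v : ℕ} (f : Fin (pairs n).length → Bool) (hu : u < n) (hv : v < n)
    (h : u ≠ v) : codeAdj n (List.ofFn f) u v = f ⟨edgePos n u v, edgePos_lt hu hv h⟩ := by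
  rw [codeAdj, List.getD_eq_getElem _ _ (by simpa using edgePos_lt hu hv h)]
  simp

theorem codeAdj_self {n : ℕ} {x : List Bool} (hx : x.length = (pairs n).length) (u : ℕ) :
    codeAdj n x u u = false := by
  have : edgePos n u u = (pairs n).length := by
    rw [edgePos, List.idxOf_eq_length_iff, mem_pairs]; omega
  rw [codeAdj, this, ← hx, List.getD_eq_default _ _ le_rfl]

open Classical in
theorem graphCode_eq {n : ℕ} (G : SimpleGraph (Fin n)) :
    graphCode G = (pairs n).map fun e =>
      decide (∃ (h₁ : e.1 < n) (h₂ : e.2 < n), G.Adj ⟨e.1, h₁⟩ ⟨e.2, h₂⟩) := by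
  have h : List.range n = (List.finRange n).map Fin.val := by simp
  rw [graphCode, pairs, List.map_flatMap, h, List.flatMap_map]
  refine List.flatMap_congr fun u _ => ?_
  rw [List.filter_map, List.map_map, List.map_map]
  simp [Function.comp_def]

theorem length_graphCode {n : ℕ} (G : SimpleGraph (Fin n)) :
    (graphCode G).length = (pairs n).length := by
  rw [graphCode_eq, List.length_map]

theorem codeAdj_graphCode {n : ℕ} (G : SimpleGraph (Fin n)) (u v : Fin n) :
    codeAdj n (graphCode G) u v = true ↔ G.Adj u v := by
  by_cases h : u = v
  · subst h
    simp [codeAdj_self (length_graphCode G)]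
  have h' : (u : ℕ) ≠ v := fun h0 => h (Fin.ext h0)
  have hlt := edgePos_lt u.2 v.2 h'
  rw [codeAdj, List.getD_eq_getElem _ _ (by rwa [length_graphCode])]
  have key : ∀ e, e = (min (u : ℕ) v, max (u : ℕ) v) →
      ((∃ (h₁ : e.1 < n) (h₂ : e.2 < n), G.Adj ⟨e.1, h₁⟩ ⟨e.2, h₂⟩) ↔ G.Adj u v) := by
    rintro e rfl
    rcases lt_or_gt_of_ne h' with h0 | h0
    · simp [min_eq_left h0.le, max_eq_right h0.le]
    · simp [min_eq_right h0.le, max_eq_left h0.le, G.adj_comm]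
  simp only [graphCode_eq, List.getElem_map, decide_eq_true_eq]
  exact key _ (List.getElem_idxOf hlt)

/-- Counting Boolean functions by a property of their restriction along an injection. -/
theorem card_filter_comp_mul {A B : Type*} [Fintype A] [Fintype B] [DecidableEq A] [DecidableEq B]
    {k : A → B} (hk : Function.Injective k) (P : (A → Bool) → Prop) [DecidablePred P] :
    (Finset.univ.filter fun f : B → Bool => P (f ∘ k)).card * 2 ^ Fintype.card A
      = (Finset.univ.filter P).card * 2 ^ Fintype.card B := by
  classical
  let e : (B → Bool) ≃ (A → Bool) × ({b // ¬ b ∈ Set.range k} → Bool) :=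
    (Equiv.piEquivPiSubtypeProd (fun b => b ∈ Set.range k) fun _ => Bool).trans
      (Equiv.prodCongr ((Equiv.ofInjective k hk).arrowCongr (Equiv.refl Bool)).symm
        (Equiv.refl _))
  have he : ∀ f, (e f).1 = f ∘ k := fun f => rfl
  have h1 : (Finset.univ.filter fun f : B → Bool => P (f ∘ k)).card
      = ((Finset.univ.filter P) ×ˢ (Finset.univ : Finset ({b // ¬ b ∈ Set.range k} → Bool))).card := by
    refine Finset.card_bij (fun f _ => e f) ?_ (fun _ _ _ _ h => e.injective h) ?_
    · intro f hf
      simpa [he] using hf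
    · intro z hz
      refine ⟨e.symm z, ?_, by simp⟩
      have := he (e.symm z)
      rw [Equiv.apply_symm_apply] at this
      simpa [← this] using hz
  have h2 : Fintype.card {b // ¬ b ∈ Set.range k} + Fintype.card A = Fintype.card B := by
    have h3 := Fintype.card_subtype_compl (fun b => b ∈ Set.range k)
    have h4 : Fintype.card {b // b ∈ Set.range k} = Fintype.card A :=
      (Fintype.card_congr (Equiv.ofInjective k hk)).symm
    have h5 := Fintype.card_subtype_le (fun b => b ∈ Set.range k)
    omega
  rw [h1, Finset.card_product, Finset.card_univ, Fintype.card_fun, Fintype.card_bool, mul_assoc,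
    ← pow_add, h2]

/-- Chernoff bound for the number of `true` values of a Boolean function. -/
theorem card_filter_le_exp {A : Type*} [Fintype A] [DecidableEq A] {s t : ℝ} (ht : 0 ≤ t) :
    ((Finset.univ.filter fun g : A → Bool =>
        s ≤ 2 * ((Finset.univ.filter fun w => g w = true).card : ℝ) - Fintype.card A).card : ℝ)
        * Real.exp (t * s)
      ≤ 2 ^ Fintype.card A * Real.exp (Fintype.card A * (t ^ 2 / 2)) := by
  have hsum : ∀ g : A → Bool,
      2 * ((Finset.univ.filter fun w => g w = true).card : ℝ) - Fintype.card A
        = ∑ w, (if g w = true then (1 : ℝ) else -1) := by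
    intro g
    have h1 : ∀ w, (if g w = true then (1 : ℝ) else -1) = 2 * (if g w = true then 1 else 0) - 1 := by
      intro w; split_ifs <;> norm_num
    rw [Finset.sum_congr rfl fun w _ => h1 w, Finset.sum_sub_distrib, ← Finset.mul_sum]
    simp
  calc _ = ∑ g ∈ Finset.univ.filter fun g : A → Bool =>
          s ≤ 2 * ((Finset.univ.filter fun w => g w = true).card : ℝ) - Fintype.card A,
            Real.exp (t * s) := by rw [Finset.sum_const, nsmul_eq_mul]
    _ ≤ ∑ g ∈ Finset.univ.filter fun g : A → Bool =>
          s ≤ 2 * ((Finset.univ.filter fun w => g w = true).card : ℝ) - Fintype.card A,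
            ∏ w, Real.exp (t * if g w = true then 1 else -1) := by
        refine Finset.sum_le_sum fun g hg => ?_
        rw [← Real.exp_sum, ← Finset.mul_sum, ← hsum]
        exact Real.exp_le_exp.2 (mul_le_mul_of_nonneg_left (Finset.mem_filter.1 hg).2 ht)
    _ ≤ ∑ g : A → Bool, ∏ w, Real.exp (t * if g w = true then 1 else -1) :=
        Finset.sum_le_sum_of_subset_of_nonneg (Finset.filter_subset _ _)
          fun g _ _ => Finset.prod_nonneg fun w _ => (Real.exp_pos _).le
    _ = ∏ w : A, ∑ b : Bool, Real.exp (t * if b = true then 1 else -1) := by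
        rw [Finset.prod_univ_sum, Fintype.piFinset_univ]
    _ = (2 * Real.cosh t) ^ Fintype.card A := by
        rw [Finset.prod_const, Finset.card_univ]
        congr 1
        simp [Real.cosh_eq]
        ring
    _ ≤ _ := by
        rw [mul_pow, Real.exp_nat_mul]
        have := Real.cosh_le_exp_half_sq t
        have := (Real.cosh_pos t).le
        gcongr

theorem card_highDegree_le {n u : ℕ} (hu : u < n) (hL : 1 ≤ Nat.log 2 n) :
    ((Finset.univ.filter fun f : Fin (pairs n).length → Bool =>
        highDegree n (List.ofFn f) u).card : ℝ)
      ≤ 2 ^ (pairs n).length * Real.exp (-(n / (2 * (Nat.log 2 n : ℝ) ^ 2))) := by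
  set L := Nat.log 2 n with hLdef
  let A := {w : Fin n // (w : ℕ) ≠ u}
  have hA : Fintype.card A = n - 1 := by
    have : Fintype.card A = Fintype.card {w : Fin n // w ≠ ⟨u, hu⟩} :=
      Fintype.card_congr (Equiv.subtypeEquivRight fun w => by simp [Fin.ext_iff])
    rw [this]
    simp
  have hA' : (Fintype.card A : ℝ) = n - 1 := by
    rw [hA, Nat.cast_sub (by omega), Nat.cast_one]
  let k : A → Fin (pairs n).length := fun w =>
    ⟨edgePos n u w.1, edgePos_lt hu w.1.2 w.2.symm⟩
  have hk : Function.Injective k := by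
    intro w w' h
    have := edgePos_inj hu w.1.2 w.2.symm (Fin.mk.inj_iff.1 h)
    refine Subtype.ext (Fin.ext ?_)
    have := w.2
    have := w'.2
    omega
  have hdeg : ∀ f : Fin (pairs n).length → Bool,
      ((List.range n).filter (codeAdj n (List.ofFn f) u)).length
        ≤ (Finset.univ.filter fun w : A => (f ∘ k) w = true).card := by
    intro f
    rw [← List.toFinset_card_of_nodup (List.nodup_range.filter _)]
    refine Finset.card_le_card_of_surjOn (fun w : A => ((w : Fin n) : ℕ)) ?_
    intro w hw
    simp only [List.coe_toFinset, List.mem_filter, List.mem_range, Set.mem_ofPred_eq] at hw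
    have hne : w ≠ u := by
      rintro rfl
      rw [codeAdj_self (by simp)] at hw
      simp at hw
    refine ⟨⟨⟨w, hw.1⟩, hne⟩, ?_, rfl⟩
    rw [codeAdj_ofFn f hu hw.1 hne.symm] at hw
    simpa [k] using hw.2
  have hL0 : (0 : ℝ) < L := by exact_mod_cast hL
  have hcount := card_filter_comp_mul hk (fun g : A → Bool => (n : ℝ) / L ≤
    2 * ((Finset.univ.filter fun w => g w = true).card : ℝ) - Fintype.card A)
  have hchern := card_filter_le_exp (A := A) (s := n / L) (t := 1 / L) (by positivity)
  have hsub : (Finset.univ.filter fun f : Fin (pairs n).length → Bool =>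
        highDegree n (List.ofFn f) u).card ≤
      (Finset.univ.filter fun f : Fin (pairs n).length → Bool => (n : ℝ) / L ≤
        2 * ((Finset.univ.filter fun w => (f ∘ k) w = true).card : ℝ) - Fintype.card A).card := by
    refine Finset.card_le_card fun f hf => ?_
    simp only [Finset.mem_filter, Finset.mem_univ, true_and, highDegree,
      decide_eq_true_eq] at hf ⊢
    rw [← hLdef] at hf
    have h1 := hf.trans_le (Nat.mul_le_mul_left L (Nat.mul_le_mul_left 2 (hdeg f)))
    rw [hA', div_le_iff₀ hL0]
    have h2 : (n : ℝ) * L + n < L * (2 *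
        ((Finset.univ.filter fun w : A => (f ∘ k) w = true).card : ℝ)) := by exact_mod_cast h1
    nlinarith
  have h2pos : (0 : ℝ) < 2 ^ Fintype.card A := by positivity
  rw [← mul_le_mul_iff_left₀ h2pos]
  have hcountR : ((Finset.univ.filter fun f : Fin (pairs n).length → Bool => (n : ℝ) / L ≤
        2 * ((Finset.univ.filter fun w => (f ∘ k) w = true).card : ℝ) - Fintype.card A).card : ℝ)
        * 2 ^ Fintype.card A = ((Finset.univ.filter fun g : A → Bool => (n : ℝ) / L ≤
    2 * ((Finset.univ.filter fun w => g w = true).card : ℝ) - Fintype.card A).card : ℝ)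
      * 2 ^ (pairs n).length := by
    rw [Fintype.card_fin] at hcount
    exact_mod_cast hcount
  refine (mul_le_mul_of_nonneg_right (Nat.cast_le.2 hsub) h2pos.le).trans ?_
  rw [hcountR]
  have hE : Real.exp (-(n / (2 * (L : ℝ) ^ 2))) * Real.exp (1 / L * (n / L))
      = Real.exp (n / (2 * (L : ℝ) ^ 2)) := by
    rw [← Real.exp_add]
    congr 1
    field_simp
    ring
  have hE2 : Real.exp (Fintype.card A * ((1 / (L : ℝ)) ^ 2 / 2))
      ≤ Real.exp (n / (2 * (L : ℝ) ^ 2)) := by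
    apply Real.exp_le_exp.2
    rw [hA', div_pow, one_pow, div_div, mul_one_div, mul_comm _ (2 : ℝ)]
    gcongr
    linarith
  have hpos := Real.exp_pos (1 / (L : ℝ) * (n / L))
  have h3 : ((Finset.univ.filter fun g : A → Bool => (n : ℝ) / L ≤
    2 * ((Finset.univ.filter fun w => g w = true).card : ℝ) - Fintype.card A).card : ℝ)
      ≤ 2 ^ Fintype.card A * Real.exp (-(n / (2 * (L : ℝ) ^ 2))) := by
    rw [← mul_le_mul_iff_left₀ hpos, mul_assoc, hE]
    exact hchern.trans (mul_le_mul_of_nonneg_left hE2 h2pos.le)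
  calc _ ≤ _ := mul_le_mul_of_nonneg_right h3 (by positivity)
    _ = _ := by ring

theorem card_noCommonNeighbour_le {n u v : ℕ} (hu : u < n) (hv : v < n)
    (hL : Nat.log 2 n ^ 2 ≤ n) :
    ((Finset.univ.filter fun f : Fin (pairs n).length → Bool =>
        noCommonNeighbour n (List.ofFn f) u v).card : ℝ)
      ≤ 2 ^ (pairs n).length * (3 / 4) ^ (Nat.log 2 n ^ 2 - 2) := by
  set M := Nat.log 2 n ^ 2 with hM
  by_cases huv : u = v
  · simp only [noCommonNeighbour, huv, decide_true, Bool.not_true, Bool.false_and]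
    simp only [Bool.false_eq_true, Finset.filter_false, Finset.card_empty, Nat.cast_zero]
    positivity
  let S := ((Finset.range M).erase u).erase v
  have hS : M - 2 ≤ S.card := by
    have h1 := Finset.pred_card_le_card_erase (s := Finset.range M) (a := u)
    have h2 := Finset.pred_card_le_card_erase (s := (Finset.range M).erase u) (a := v)
    rw [Finset.card_range] at h1
    change M - 2 ≤ (((Finset.range M).erase u).erase v).card
    omega
  have hmem : ∀ w : S, (w : ℕ) ≠ u ∧ (w : ℕ) ≠ v ∧ (w : ℕ) < M := by
    intro w
    have := w.2
    simp only [S, Finset.mem_erase, Finset.mem_range] at this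
    tauto
  let z : Bool → ℕ := fun b => cond b u v
  have hz : ∀ b, z b < n := by rintro (_ | _) <;> assumption
  have hzw : ∀ (w : S) b, z b ≠ w := by
    rintro w (_ | _)
    · exact (hmem w).2.1.symm
    · exact (hmem w).1.symm
  have hlt : ∀ w : S, (w : ℕ) < n := fun w => (hmem w).2.2.trans_le hL
  let k : S × Bool → Fin (pairs n).length := fun p =>
    ⟨edgePos n (z p.2) p.1, edgePos_lt (hz _) (hlt _) (hzw _ _)⟩
  have hk : Function.Injective k := by
    rintro ⟨w, b⟩ ⟨w', b'⟩ h
    rcases edgePos_inj (hz _) (hlt _) (hzw _ _) (Fin.mk.inj_iff.1 h) with h | h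
    · refine Prod.ext (Subtype.ext h.2) ?_
      have := h.1
      cases b <;> cases b' <;> simp [z] at this ⊢ <;> omega
    · exact absurd h.1 (hzw _ _)
  let P : (S × Bool → Bool) → Prop := fun g => ∀ w, ¬ (g (w, true) = true ∧ g (w, false) = true)
  have hP : (Finset.univ.filter P).card = 3 ^ S.card := by
    have h1 : (Finset.univ.filter P).card = (Fintype.piFinset fun _ : S =>
        (Finset.univ.filter fun h : Bool → Bool => ¬ (h true = true ∧ h false = true))).card := by
      refine Finset.card_bij (fun g _ => Equiv.curry S Bool Bool g) ?_
        (fun _ _ _ _ h => (Equiv.curry S Bool Bool).injective h) ?_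
      · intro g hg
        simpa [P, Fintype.mem_piFinset] using hg
      · intro h hh
        refine ⟨(Equiv.curry S Bool Bool).symm h, ?_, by simp⟩
        simpa [P, Fintype.mem_piFinset] using hh
    have h2 : (Finset.univ.filter fun h : Bool → Bool =>
        ¬ (h true = true ∧ h false = true)).card = 3 := by decide
    rw [h1, Fintype.card_piFinset, Finset.prod_const, h2, Finset.card_univ, Fintype.card_coe]
  have hcount := card_filter_comp_mul hk P
  have hsub : (Finset.univ.filter fun f : Fin (pairs n).length → Bool =>
        noCommonNeighbour n (List.ofFn f) u v).card ≤
      (Finset.univ.filter fun f : Fin (pairs n).length → Bool => P (f ∘ k)).card := by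
    refine Finset.card_le_card fun f hf => ?_
    simp only [Finset.mem_filter, Finset.mem_univ, true_and, noCommonNeighbour, huv,
      decide_false, Bool.not_false, Bool.true_and, Bool.not_eq_true', List.any_eq_false,
      List.mem_range, Bool.and_eq_true] at hf ⊢
    intro w hw
    apply hf w (hmem w).2.2
    rwa [codeAdj_ofFn f hu (hlt w) (hmem w).1.symm, codeAdj_ofFn f hv (hlt w) (hmem w).2.1.symm]
  rw [hP, Fintype.card_prod, Fintype.card_coe, Fintype.card_bool, Fintype.card_fin, mul_comm _ 2,
    pow_mul] at hcount
  have hcountR : ((Finset.univ.filter fun f : Fin (pairs n).length → Bool => P (f ∘ k)).card : ℝ)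
      * 4 ^ S.card = 3 ^ S.card * 2 ^ (pairs n).length := by
    norm_num at hcount
    exact_mod_cast hcount
  calc _ ≤ ((Finset.univ.filter fun f : Fin (pairs n).length → Bool => P (f ∘ k)).card : ℝ) :=
        Nat.cast_le.2 hsub
    _ = 2 ^ (pairs n).length * (3 / 4) ^ S.card := by
        rw [div_pow, mul_div_assoc', eq_div_iff (by positivity), hcountR, mul_comm]
    _ ≤ _ := by
        gcongr ?_ * ?_
        exact pow_le_pow_of_le_one (by norm_num) (by norm_num) hS

theorem card_atypical_le {n : ℕ} (hL : 1 ≤ Nat.log 2 n) (hL2 : Nat.log 2 n ^ 2 ≤ n) :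
    ((Finset.univ.filter fun f : Fin (pairs n).length → Bool =>
        atypical n (List.ofFn f)).card : ℝ)
      ≤ 2 ^ (pairs n).length * (n * Real.exp (-(n / (2 * (Nat.log 2 n : ℝ) ^ 2)))
        + n ^ 2 * (3 / 4) ^ (Nat.log 2 n ^ 2 - 2)) := by
  classical
  have hsub : (Finset.univ.filter fun f : Fin (pairs n).length → Bool =>
        atypical n (List.ofFn f)) ⊆
      ((Finset.range n).biUnion fun u => Finset.univ.filter fun f : Fin (pairs n).length → Bool =>
        highDegree n (List.ofFn f) u) ∪
      ((Finset.range n ×ˢ Finset.range n).biUnion fun e =>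
        Finset.univ.filter fun f : Fin (pairs n).length → Bool =>
          noCommonNeighbour n (List.ofFn f) e.1 e.2) := by
    intro f hf
    simp only [atypical, Finset.mem_filter, Finset.mem_univ, true_and, Bool.or_eq_true,
      List.any_eq_true, List.mem_range] at hf
    simp only [Finset.mem_union, Finset.mem_biUnion, Finset.mem_filter, Finset.mem_univ, true_and,
      Finset.mem_product, Finset.mem_range]
    rcases hf with ⟨u, hu, h⟩ | ⟨u, hu, v, hv, h⟩
    · exact Or.inl ⟨u, hu, h⟩
    · exact Or.inr ⟨(u, v), ⟨hu, hv⟩, h⟩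
  have h1 := (Finset.card_le_card hsub).trans ((Finset.card_union_le _ _).trans
    (add_le_add Finset.card_biUnion_le Finset.card_biUnion_le))
  refine (Nat.cast_le (α := ℝ).2 h1).trans ?_
  rw [Nat.cast_add, Nat.cast_sum, Nat.cast_sum]
  refine (add_le_add
    (Finset.sum_le_sum fun u hu => card_highDegree_le (Finset.mem_range.1 hu) hL)
    (Finset.sum_le_sum fun e he => card_noCommonNeighbour_le
      (Finset.mem_range.1 (Finset.mem_product.1 he).1)
      (Finset.mem_range.1 (Finset.mem_product.1 he).2) hL2)).trans (le_of_eq ?_)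
  rw [Finset.sum_const, Finset.sum_const, Finset.card_product, Finset.card_range, nsmul_eq_mul,
    nsmul_eq_mul]
  push_cast
  ring

theorem tendsto_log_two_atTop : Tendsto (Nat.log 2) atTop atTop :=
  tendsto_atTop.2 fun b => (eventually_ge_atTop (2 ^ b)).mono fun _ hn =>
    Nat.le_log_of_pow_le (by norm_num) hn

theorem eventually_two_mul_pow_four_le : ∀ᶠ k : ℕ in atTop, 2 * k ^ 4 ≤ 2 ^ k := by
  have h := tendsto_pow_const_div_const_pow_of_one_lt 4 (one_lt_two (α := ℝ))
  filter_upwards [h.eventually (ge_mem_nhds (show (0 : ℝ) < 1 / 2 by norm_num))] with k hk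
  have h2 : (0 : ℝ) < 2 ^ k := by positivity
  rw [div_le_iff₀ h2] at hk
  have : (2 : ℝ) * k ^ 4 ≤ 2 ^ k := by linarith
  exact_mod_cast this

theorem exp_neg_le_half_pow (k : ℕ) : Real.exp (-(k : ℝ)) ≤ (1 / 2) ^ k := by
  have h : Real.exp (-1) ≤ 1 / 2 := by
    have := Real.add_one_le_exp (1 : ℝ)
    rw [Real.exp_neg, one_div]
    exact inv_anti₀ (by norm_num) (by linarith)
  calc Real.exp (-(k : ℝ)) = Real.exp (-1) ^ k := by rw [← Real.exp_nat_mul]; simp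
    _ ≤ _ := by gcongr

/-- The proportion of atypical graphs decreases faster than `2 ^ (- D log n - a)`. -/
theorem eventually_two_pow_mul_le (D a : ℕ) : ∀ᶠ n : ℕ in atTop,
    1 ≤ Nat.log 2 n ∧ Nat.log 2 n ^ 2 ≤ n ∧ D * (Nat.log 2 n + 1) + a ≤ n * (n - 1) / 2 ∧
    (2 : ℝ) ^ (D * (Nat.log 2 n + 1) + a) * (n * Real.exp (-(n / (2 * (Nat.log 2 n : ℝ) ^ 2)))
        + n ^ 2 * (3 / 4) ^ (Nat.log 2 n ^ 2 - 2)) ≤ 1 := by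
  filter_upwards [tendsto_log_two_atTop.eventually eventually_two_mul_pow_four_le,
    tendsto_log_two_atTop.eventually (eventually_ge_atTop (6 * (D + 2) + 3 * (a + 1) + 2)),
    eventually_ge_atTop 2] with n h1 h2 h3
  set L := Nat.log 2 n with hLdef
  set e := (D + 2) * (L + 1) + a + 1 with he
  have hL1 : 1 ≤ L := by omega
  have hpow : 2 ^ L ≤ n := Nat.pow_log_le_self 2 (by omega)
  have hlt : n < 2 ^ (L + 1) := Nat.lt_pow_succ_log_self (by norm_num) n
  have he2 : 3 * e + 2 ≤ L ^ 2 := by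
    rw [he]
    have h4 : (6 * (D + 2) + 3 * (a + 1) + 2) * L ≤ L ^ 2 := by
      rw [sq]; exact Nat.mul_le_mul_right _ h2
    nlinarith
  have hL24 : L ^ 2 ≤ L ^ 4 := Nat.pow_le_pow_right hL1 (by norm_num)
  have hN : n - 1 ≤ n * (n - 1) / 2 := by
    rw [Nat.le_div_iff_mul_le (by norm_num), mul_comm]
    exact Nat.mul_le_mul_right _ h3
  have hDe : D * (L + 1) + a + 2 * (L + 1) + 1 = e := by rw [he]; ring
  refine ⟨hL1, by omega, by omega, ?_⟩
  have hL0 : (0 : ℝ) < L := by exact_mod_cast hL1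
  have hexp : Real.exp (-(n / (2 * (L : ℝ) ^ 2))) ≤ (3 / 4) ^ (L ^ 2 - 2) := by
    calc Real.exp (-(n / (2 * (L : ℝ) ^ 2))) ≤ Real.exp (-((L ^ 2 : ℕ) : ℝ)) := by
          apply Real.exp_le_exp.2
          apply neg_le_neg
          rw [le_div_iff₀ (by positivity)]
          have : 2 * L ^ 4 ≤ n := h1.trans hpow
          have : (2 : ℝ) * (L : ℝ) ^ 4 ≤ n := by exact_mod_cast this
          push_cast
          nlinarith
      _ ≤ (1 / 2) ^ (L ^ 2) := exp_neg_le_half_pow _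
      _ ≤ (3 / 4) ^ (L ^ 2) := pow_le_pow_left₀ (by norm_num) (by norm_num) _
      _ ≤ _ := pow_le_pow_of_le_one (by norm_num) (by norm_num) (Nat.sub_le _ _)
  have h34 : (3 / 4 : ℝ) ^ (L ^ 2 - 2) ≤ (1 / 2) ^ e := by
    calc (3 / 4 : ℝ) ^ (L ^ 2 - 2) ≤ (3 / 4) ^ (3 * e) :=
          pow_le_pow_of_le_one (by norm_num) (by norm_num) (by omega)
      _ = ((3 / 4) ^ 3) ^ e := pow_mul _ _ _
      _ ≤ _ := by gcongr; norm_num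
  have hnR : (n : ℝ) ≤ 2 ^ (L + 1) := by exact_mod_cast hlt.le
  have hn1 : (1 : ℝ) ≤ n := by exact_mod_cast (by omega : 1 ≤ n)
  have hsum : (n : ℝ) * Real.exp (-(n / (2 * (L : ℝ) ^ 2))) + n ^ 2 * (3 / 4) ^ (L ^ 2 - 2)
      ≤ 2 ^ (2 * (L + 1) + 1) * (1 / 2) ^ e := by
    calc _ ≤ (n : ℝ) ^ 2 * (3 / 4) ^ (L ^ 2 - 2) + n ^ 2 * (3 / 4) ^ (L ^ 2 - 2) := by
          gcongr
          nlinarith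
      _ = 2 * n ^ 2 * (3 / 4) ^ (L ^ 2 - 2) := by ring
      _ ≤ 2 * (2 ^ (L + 1)) ^ 2 * (1 / 2) ^ e := by gcongr
      _ = _ := by rw [← pow_mul]; ring
  calc _ ≤ (2 : ℝ) ^ (D * (L + 1) + a) * (2 ^ (2 * (L + 1) + 1) * (1 / 2) ^ e) := by gcongr
    _ = 2 ^ e * (1 / 2) ^ e := by rw [← mul_assoc, ← pow_add, ← hDe]; ring_nf
    _ = 1 := by rw [← mul_pow]; norm_num

/-- Every sufficiently large graph of logarithmic randomness deficiency is typical. -/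
theorem eventually_not_atypical {δ : ℕ → ℕ}
    (hδ : (fun n : ℕ => (δ n : ℝ)) =O[atTop] fun n : ℕ => Real.logb 2 n) :
    ∀ᶠ n : ℕ in atTop, ∀ G : SimpleGraph (Fin n), IsRandomGraph (δ n) G →
      atypical n (graphCode G) = false := by
  obtain ⟨c, hc⟩ := exists_condComplexity_atypical_le
  obtain ⟨C, hC⟩ := hδ.bound
  obtain ⟨D, hD⟩ := exists_nat_ge C
  filter_upwards [hC, eventually_two_pow_mul_le D (c + 1), eventually_ge_atTop 1]
    with n hn ⟨hL1, hL2, hN, hsmall⟩ hn1 G hG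
  by_contra hat
  rw [Bool.not_eq_false] at hat
  have hδD : δ n ≤ D * (Nat.log 2 n + 1) := by
    have h0 : (0 : ℝ) ≤ Real.logb 2 n :=
      Real.logb_nonneg (by norm_num) (by exact_mod_cast hn1)
    have h1 : Real.logb 2 n ≤ (Nat.log 2 n + 1 : ℕ) := by
      rw [Real.logb_le_iff_le_rpow (by norm_num) (by exact_mod_cast hn1), Real.rpow_natCast]
      exact_mod_cast (Nat.lt_pow_succ_log_self (by norm_num) n).le
    rw [Real.norm_natCast, Real.norm_of_nonneg h0] at hn
    have h2 : (δ n : ℝ) ≤ D * (Nat.log 2 n + 1 : ℕ) :=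
      hn.trans ((mul_le_mul_of_nonneg_right hD h0).trans
        (mul_le_mul_of_nonneg_left h1 (Nat.cast_nonneg D)))
    exact_mod_cast h2
  set k := D * (Nat.log 2 n + 1) + (c + 1) with hk
  have hcard := card_atypical_le hL1 hL2
  rw [← length_pairs] at hN
  have hcard' : (Finset.univ.filter fun f : Fin (pairs n).length → Bool =>
      atypical n (List.ofFn f)).card ≤ 2 ^ ((pairs n).length - k) := by
    have h2 : (0 : ℝ) < 2 ^ k := by positivity
    have h3 : ((Finset.univ.filter fun f : Fin (pairs n).length → Bool =>
        atypical n (List.ofFn f)).card : ℝ) ≤ 2 ^ ((pairs n).length - k) := by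
      rw [← mul_le_mul_iff_right₀ h2, ← pow_add, Nat.add_sub_cancel' hN]
      refine (mul_le_mul_of_nonneg_left hcard h2.le).trans ?_
      rw [mul_left_comm]
      exact mul_le_of_le_one_right (by positivity) hsmall
    exact_mod_cast h3
  have h4 := hc n (δ n) _ hcard' (graphCode G) (length_graphCode G) hat
  rw [IsRandomGraph, ← length_pairs] at hG
  omega

/-- In a typical graph all degrees are at most `n / 2 + n / (2 log n)`, and any two nodes have a
common neighbour among the first `(log n) ^ 2` nodes. -/
theorem atypical_eq_false_iff {n : ℕ} {x : List Bool} :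
    atypical n x = false ↔
      (∀ u < n, Nat.log 2 n * (2 * ((List.range n).filter (codeAdj n x u)).length)
        ≤ n * Nat.log 2 n + n) ∧
      ∀ u < n, ∀ v < n, u ≠ v →
        ∃ w < Nat.log 2 n ^ 2, codeAdj n x u w = true ∧ codeAdj n x v w = true := by
  simp only [atypical, highDegree, noCommonNeighbour, Bool.or_eq_false_iff, List.any_eq_false,
    List.mem_range, decide_eq_true_eq, not_lt, Bool.and_eq_true, Bool.not_eq_true',
    decide_eq_false_iff_not, not_and, List.any_eq_true]
  push Not
  rfl

/-- The argument of the first entry of a table, a number of `k` bits. -/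
def entryArg (k : ℕ) (t : List Bool) : ℕ := bitsVal (t.tail.take k)

/-- Removes the first entry of a table, a flag followed by a number of `l` or `m` bits. -/
def skipEntry (l m : ℕ) (t : List Bool) : List Bool := t.drop (cond t.headI l m + 1)

/-- Looks up the port for destination `i` in a table: an entry with flag `true` contains a port, and
an entry with flag `false` refers to another entry. -/
def tableLookup (l m : ℕ) (t : List Bool) (i : ℕ) : ℕ :=
  cond ((skipEntry l m)^[i] t).headI (entryArg l ((skipEntry l m)^[i] t))
    (entryArg l ((skipEntry l m)^[entryArg m ((skipEntry l m)^[i] t)] t))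

/-- Splits a self-delimiting unary number off a string. -/
def splitUnary (q : List Bool) : ℕ × List Bool := ((q.takeWhile id).length, (q.dropWhile id).tail)

/-- The interpreter of routing tables: the two field widths precede the table in unary. -/
def runTable (q : List Bool) (y : ℕ) : ℕ :=
  tableLookup (splitUnary q).1 (splitUnary (splitUnary q).2).1 (splitUnary (splitUnary q).2).2
    (y - 1) + 1

theorem primrec_entryArg : Primrec₂ entryArg :=
  primrec_bitsVal.comp (Primrec.list_take.comp Primrec.fst (Primrec.list_tail.comp Primrec.snd))

theorem primrec_tableLookup {α : Type*} [Primcodable α] {l m i : α → ℕ} {t : α → List Bool}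
    (hl : Primrec l) (hm : Primrec m) (ht : Primrec t) (hi : Primrec i) :
    Primrec fun a => tableLookup (l a) (m a) (t a) (i a) := by
  have hit : ∀ {j : α → ℕ}, Primrec j → Primrec fun a => (skipEntry (l a) (m a))^[j a] (t a) := by
    intro j hj
    refine Primrec.nat_iterate hj ht (Primrec₂.mk ?_)
    exact Primrec.list_drop.comp (Primrec.succ.comp (Primrec.cond
      (Primrec.list_headI.comp Primrec.snd) (hl.comp Primrec.fst) (hm.comp Primrec.fst)))
      Primrec.snd
  exact Primrec.cond (Primrec.list_headI.comp (hit hi)) (primrec_entryArg.comp hl (hit hi))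
    (primrec_entryArg.comp hl (hit (primrec_entryArg.comp hm (hit hi))))

theorem primrec_splitUnary : Primrec splitUnary :=
  (Primrec.list_length.comp (Primrec.list_takeWhile Primrec.id)).pair
    (Primrec.list_tail.comp (Primrec.list_dropWhile Primrec.id))

theorem primrec_runTable : Primrec₂ runTable := by
  have h := primrec_splitUnary.comp (Primrec.fst (α := List Bool) (β := ℕ))
  have h' := primrec_splitUnary.comp (Primrec.snd.comp h)
  exact Primrec.succ.comp (primrec_tableLookup (Primrec.fst.comp h) (Primrec.fst.comp h')
    (Primrec.snd.comp h') (Primrec.pred.comp Primrec.snd))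

theorem splitUnary_replicate (l : ℕ) (q : List Bool) :
    splitUnary (List.replicate l true ++ false :: q) = (l, q) := by
  unfold splitUnary
  rw [List.takeWhile_append_of_pos (by simp), List.dropWhile_append_of_pos (by simp)]
  simp

theorem iterate_skipEntry {l m : ℕ} {b : ℕ → Bool} {e : ℕ → List Bool}
    (he : ∀ i, (e i).length = cond (b i) l m) (i : ℕ) : ∀ j k : ℕ,
    (skipEntry l m)^[i] ((List.range' j (i + k)).flatMap fun i => b i :: e i)
      = (List.range' (j + i) k).flatMap fun i => b i :: e i := by
  induction i with
  | zero => intro j k; simp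
  | succ i ih =>
    intro j k
    have h : skipEntry l m ((List.range' j (i + 1 + k)).flatMap fun i => b i :: e i)
        = (List.range' (j + 1) (i + k)).flatMap fun i => b i :: e i := by
      rw [show i + 1 + k = (i + k) + 1 by omega, List.range'_succ, List.flatMap_cons, skipEntry]
      simp [he]
    rw [Function.iterate_succ_apply, h, ih, show j + 1 + i = j + (i + 1) by omega]

theorem iterate_skipEntry_range {l m n : ℕ} {b : ℕ → Bool} {e : ℕ → List Bool}
    (he : ∀ i, (e i).length = cond (b i) l m) {i : ℕ} (hi : i < n) :
    ∃ r, (skipEntry l m)^[i] ((List.range n).flatMap fun i => b i :: e i) = b i :: (e i ++ r) := by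
  obtain ⟨k, rfl⟩ : ∃ k, n = i + (k + 1) := ⟨n - i - 1, by omega⟩
  refine ⟨(List.range' (i + 1) k).flatMap fun i => b i :: e i, ?_⟩
  rw [List.range_eq_range', iterate_skipEntry he, List.range'_succ, List.flatMap_cons, zero_add]
  rfl

/-- Routing tables as programs: a table whose entry at `i` is either a port of `l` bits
(`b i = true`) or a reference of `m` bits to another entry. -/
theorem exists_table_program : ∃ c : ℕ, ∀ (l m n : ℕ) (b : ℕ → Bool) (a : ℕ → ℕ),
    (∀ i, a i < 2 ^ cond (b i) l m) →
    ∃ F : List Bool,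
      F.length = c + l + m + n + ((List.range n).map fun i => cond (b i) l m).sum ∧
      (∀ i < n, b i = true → universalMachine F (i + 1) = Part.some (a i + 1)) ∧
      ∀ i < n, b i = false → a i < n → b (a i) = true →
        universalMachine F (i + 1) = Part.some (a (a i) + 1) := by
  obtain ⟨s, hs⟩ := universalMachine_universal (fun z => (runTable z.1 z.2 : ℕ))
    primrec_runTable.to_comp.partrec
  refine ⟨s.length + 2, fun l m n b a ha => ?_⟩
  choose e he hv using fun i => exists_bits _ _ (ha i)
  let t := (List.range n).flatMap fun i => b i :: e i
  refine ⟨s ++ (List.replicate l true ++ false :: (List.replicate m true ++ false :: t)),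
    ?_, ?_, ?_⟩
  · have : t.length = n + ((List.range n).map fun i => cond (b i) l m).sum := by
      simp only [t, List.length_flatMap, List.length_cons, he, List.sum_map_add]
      simp [add_comm]
    simp [this]
    omega
  all_goals
    intro i hi hb
    obtain ⟨r, hr⟩ := iterate_skipEntry_range he hi
    rw [hs]
    simp only [runTable, splitUnary_replicate, Nat.add_sub_cancel, tableLookup]
    simp only [t, hr, List.headI_cons, hb, cond_true, cond_false]
  · have h1 := he i
    rw [hb, cond_true] at h1
    simp [entryArg, ← h1, hv]
  · intro ha hb'
    have h1 := he i
    rw [hb, cond_false] at h1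
    have h2 : entryArg m (false :: (e i ++ r)) = a i := by
      simp [entryArg, ← h1, hv]
    obtain ⟨r', hr'⟩ := iterate_skipEntry_range he ha
    have h3 := he (a i)
    rw [hb', cond_true] at h3
    rw [h2, hr']
    simp [entryArg, ← h3, hv]

/-- If any two nodes have a common neighbour and every node forwards messages to neighbours
directly and all other messages to a common neighbour, then the scheme is shortest-path. -/
theorem isShortestPathRouting_of_forwards {n : ℕ} {G : SimpleGraph (Fin n)} {π : PortAssignment G}
    {F : Fin n → List Bool} (h₁ : ∀ u v, G.Adj u v → Forwards π F v u v)
    (h₂ : ∀ u v, u ≠ v → ¬ G.Adj u v → ∃ w, G.Adj u w ∧ G.Adj w v ∧ Forwards π F v u w) :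
    IsShortestPathRouting π F := by
  intro u v
  by_cases huv : u = v
  · subst huv
    exact ⟨SimpleGraph.Reachable.refl _, by rw [SimpleGraph.dist_self]; exact Route.arrived⟩
  by_cases hadj : G.Adj u v
  · refine ⟨hadj.reachable, ?_⟩
    rw [SimpleGraph.dist_eq_one_iff_adj.2 hadj]
    exact Route.step huv (h₁ u v hadj) Route.arrived
  · obtain ⟨w, huw, hwv, hf⟩ := h₂ u v huv hadj
    have hr : G.Reachable u v := huw.reachable.trans hwv.reachable
    have hle : G.dist u v ≤ 2 :=
      SimpleGraph.dist_le (SimpleGraph.Walk.cons huw (SimpleGraph.Walk.cons hwv .nil))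
    have h0 : G.dist u v ≠ 0 := fun h => huv (hr.dist_eq_zero_iff.1 h)
    have h1 : G.dist u v ≠ 1 := fun h => hadj (SimpleGraph.dist_eq_one_iff_adj.1 h)
    refine ⟨hr, ?_⟩
    rw [show G.dist u v = 0 + 1 + 1 by omega]
    exact Route.step huv hf (Route.step hwv.ne (h₁ w v hwv) Route.arrived)

/-- Shortest-path routing tables in a graph where any two nodes have a common neighbour among the
first `M` nodes. -/
theorem exists_shortestPathRouting : ∃ c : ℕ, ∀ (n l m M : ℕ) (G : SimpleGraph (Fin n))
    (π : PortAssignment G), n ≤ 2 ^ l → M ≤ 2 ^ m →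
    (∀ u < n, ∀ v < n, u ≠ v →
      ∃ w < M, codeAdj n (graphCode G) u w = true ∧ codeAdj n (graphCode G) v w = true) →
    ∃ F : Fin n → List Bool, IsShortestPathRouting π F ∧ ∀ u, (F u).length ≤
      c + l + m + n + ((List.range n).filter (codeAdj n (graphCode G) u)).length * l + n * m := by
  classical
  obtain ⟨c, hc⟩ := exists_table_program
  refine ⟨c, fun n l m M G π hl hm hM => ?_⟩
  have hlt : ∀ u w, codeAdj n (graphCode G) u w = true → w < n := by
    intro u w h
    by_contra hw
    have hpos : edgePos n u w = (pairs n).length := by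
      rw [edgePos, List.idxOf_eq_length_iff, mem_pairs]
      omega
    rw [codeAdj, hpos, ← length_graphCode G, List.getD_eq_default _ _ le_rfl] at h
    exact Bool.noConfusion h
  let via : Fin n → ℕ → ℕ := fun u v =>
    if h : ∃ w < M, codeAdj n (graphCode G) u w = true ∧ codeAdj n (graphCode G) v w = true
    then h.choose else 0
  let a : Fin n → ℕ → ℕ := fun u v =>
    if h : ∃ hv : v < n, G.Adj u ⟨v, hv⟩ then (π u ⟨⟨v, h.choose⟩, h.choose_spec⟩ : ℕ) else via u v
  have hb : ∀ u v : Fin n, codeAdj n (graphCode G) u v = true ↔ G.Adj u v :=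
    codeAdj_graphCode G
  have hport : ∀ (u v : Fin n) (h : G.Adj u v), a u v = (π u ⟨v, h⟩ : ℕ) := by
    intro u v h
    have h' : ∃ hv : (v : ℕ) < n, G.Adj u ⟨v, hv⟩ := ⟨v.2, h⟩
    simp only [a, dif_pos h']
  have hvia : ∀ (u v : Fin n), u ≠ v → ¬ G.Adj u v →
      ∃ w : Fin n, a u v = w ∧ G.Adj u w ∧ G.Adj v w := by
    intro u v huv h
    have h' : ¬ ∃ hv : (v : ℕ) < n, G.Adj u ⟨v, hv⟩ := fun ⟨_, h0⟩ => h h0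
    have hw := hM u u.2 v v.2 fun h0 => huv (Fin.ext h0)
    have hw' := hw.choose_spec
    refine ⟨⟨hw.choose, hlt _ _ hw'.2.1⟩, ?_, (hb _ _).1 hw'.2.1, (hb _ _).1 hw'.2.2⟩
    simp only [a, dif_neg h', via, dif_pos hw]
  have ha : ∀ u v, a u v < 2 ^ cond (codeAdj n (graphCode G) (u : Fin n) v) l m := by
    intro u v
    cases hcode : codeAdj n (graphCode G) u v
    · have h' : ¬ ∃ hv : v < n, G.Adj u ⟨v, hv⟩ := by
        rintro ⟨hv, h0⟩
        rw [← hb] at h0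
        simp [hcode] at h0
      simp only [a, dif_neg h', via, cond_false]
      split_ifs with h
      · exact h.choose_spec.1.trans_le hm
      · positivity
    · have hv := hlt _ _ hcode
      have h' : G.Adj u ⟨v, hv⟩ := (hb u ⟨v, hv⟩).1 hcode
      rw [hport u ⟨v, hv⟩ h', cond_true]
      refine (π u ⟨⟨v, hv⟩, h'⟩).2.trans_le (le_trans ?_ hl)
      rw [Nat.card_eq_fintype_card]
      exact (Fintype.card_subtype_le _).trans_eq (Fintype.card_fin n)
  choose F hF using fun u : Fin n => hc l m n (fun v => codeAdj n (graphCode G) u v) (a u) (ha u)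
  refine ⟨F, isShortestPathRouting_of_forwards ?_ ?_, fun u => ?_⟩
  · intro u v h
    refine ⟨h, ?_⟩
    rw [nodeLabel, (hF u).2.1 v v.2 ((hb u v).2 h), portLabel, hport u v h]
    exact Part.mem_some _
  · intro u v huv h
    obtain ⟨w, hw, huw, hvw⟩ := hvia u v huv h
    refine ⟨w, huw, hvw.symm, huw, ?_⟩
    have hcode : codeAdj n (graphCode G) u v = false := by
      rw [← Bool.not_eq_true, hb]; exact h
    rw [nodeLabel, (hF u).2.2 v v.2 hcode (hw ▸ w.2) (by rw [hw]; exact (hb u w).2 huw), portLabel,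
      hw, hport u w huw]
    exact Part.mem_some _
  · rw [(hF u).1]
    have hsum : ∀ (p : ℕ → Bool) (s : List ℕ),
        (s.map fun i => cond (p i) l m).sum ≤ (s.filter p).length * l + s.length * m := by
      intro p s
      induction s with
      | nil => simp
      | cons i s ih => cases hp : p i <;> simp [hp] <;> nlinarith
    have := hsum (codeAdj n (graphCode G) u) (List.range n)
    rw [List.length_range] at this
    omega

theorem tendsto_routing_overhead :
    Tendsto (fun n : ℕ => (11 + 4 * (Nat.log 2 (Nat.log 2 n) : ℝ)) / (Nat.log 2 n : ℝ))
      atTop (𝓝 0) := by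
  have h : Tendsto (fun k : ℕ => (11 + 4 * (Nat.log 2 k : ℝ)) / (k : ℝ)) atTop (𝓝 0) := by
    have h1 : Tendsto (fun k : ℕ => 11 / (k : ℝ)) atTop (𝓝 0) :=
      tendsto_const_div_atTop_nhds_zero_nat 11
    have h2 : Tendsto (fun k : ℕ => Real.log k / (k : ℝ)) atTop (𝓝 0) :=
      (Real.isLittleO_log_id_atTop.tendsto_div_nhds_zero).comp tendsto_natCast_atTop_atTop
    have h3 := h1.add (h2.const_mul (4 / Real.log 2))
    rw [mul_zero, add_zero] at h3
    refine squeeze_zero (fun k => by positivity) (fun k => ?_) h3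
    have h4 : (Nat.log 2 k : ℝ) ≤ Real.log k / Real.log 2 := by
      have := Real.natLog_le_logb k 2
      rwa [Real.logb, Nat.cast_ofNat] at this
    calc (11 + 4 * (Nat.log 2 k : ℝ)) / (k : ℝ)
        ≤ (11 + 4 * (Real.log k / Real.log 2)) / (k : ℝ) := by gcongr
      _ = _ := by ring
  exact h.comp tendsto_log_two_atTop

/-- The size of the routing tables is `(n / 2) log n (1 + o(1))`. -/
theorem eventually_table_length_le (c : ℕ) : ∀ᶠ n : ℕ in atTop, ∀ deg len : ℕ,
    Nat.log 2 n * (2 * deg) ≤ n * Nat.log 2 n + n →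
    len ≤ c + (Nat.log 2 n + 1) + (2 * Nat.log 2 (Nat.log 2 n) + 2) + n
      + deg * (Nat.log 2 n + 1) + n * (2 * Nat.log 2 (Nat.log 2 n) + 2) →
    (len : ℝ) ≤ (n : ℝ) / 2 * Real.logb 2 n *
      (1 + (11 + 4 * (Nat.log 2 (Nat.log 2 n) : ℝ)) / (Nat.log 2 n : ℝ)) := by
  filter_upwards [tendsto_log_two_atTop.eventually eventually_two_mul_pow_four_le,
    tendsto_log_two_atTop.eventually (eventually_ge_atTop (c + 5)),
    eventually_ge_atTop 1] with n h1 h2 h3 deg len hdeg hlen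
  set L := Nat.log 2 n with hL
  set K := Nat.log 2 L
  have hK : K ≤ L := Nat.log_le_self 2 L
  have hn : 2 ^ L ≤ n := Nat.pow_log_le_self 2 (by omega)
  have hsmall : c + (L + 1) + (2 * K + 2) ≤ n := by
    have h4 : L * 2 ≤ L ^ 4 := by
      rw [show L ^ 4 = L * L ^ 3 by ring]
      refine Nat.mul_le_mul_left _ ?_
      calc 2 ≤ L := by omega
        _ ≤ L ^ 3 := Nat.le_self_pow (by norm_num) L
    omega
  have hL0 : (0 : ℝ) < L := by exact_mod_cast (by omega : 0 < L)
  have hL1 : (1 : ℝ) ≤ L := by exact_mod_cast (by omega : 1 ≤ L)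
  have hlog : (L : ℝ) ≤ Real.logb 2 n := by
    have := Real.natLog_le_logb n 2
    rwa [Nat.cast_ofNat] at this
  have hn0 : (0 : ℝ) ≤ n := Nat.cast_nonneg n
  have hdegR : (deg : ℝ) ≤ n / 2 + n / (2 * L) := by
    have h5 : (L : ℝ) * (2 * deg) ≤ n * L + n := by exact_mod_cast hdeg
    rw [div_add_div _ _ (by norm_num) (by positivity), le_div_iff₀ (by positivity)]
    nlinarith
  have hlenR : (len : ℝ) ≤ n + n + deg * (L + 1) + n * (2 * K + 2) := by
    have : len ≤ n + n + deg * (L + 1) + n * (2 * K + 2) := by omega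
    exact_mod_cast this
  have hport : (deg : ℝ) * (L + 1) ≤ n / 2 * (L + 3) := by
    calc (deg : ℝ) * (L + 1) ≤ (n / 2 + n / (2 * L)) * (L + 1) := by gcongr
      _ = n / 2 * (L + 2 + 1 / L) := by field_simp; ring
      _ ≤ _ := by
        have : 1 / (L : ℝ) ≤ 1 := by rw [div_le_one hL0]; exact hL1
        exact mul_le_mul_of_nonneg_left (by linarith) (by positivity)
  calc (len : ℝ) ≤ n / 2 * (L + (11 + 4 * K)) := by nlinarith
    _ = n / 2 * L * (1 + (11 + 4 * K) / L) := by field_simp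
    _ ≤ _ := by gcongr

end CompactRouting

theorem mainTheorem4 (δ : ℕ → ℕ)
    (hδ : (fun n : ℕ => (δ n : ℝ)) =O[atTop] fun n : ℕ => Real.logb 2 n) :
    ∃ ε : ℕ → ℝ, Tendsto ε atTop (𝓝 0) ∧
      ∀ᶠ n : ℕ in atTop, ∀ G : SimpleGraph (Fin n), CompactRouting.IsRandomGraph (δ n) G →
        ∀ π : CompactRouting.PortAssignment G,
          ∃ F : Fin n → List Bool, CompactRouting.IsShortestPathRouting π F ∧
            (∀ u : Fin n, ((F u).length : ℝ) ≤ (n : ℝ) / 2 * Real.logb 2 n * (1 + ε n)) ∧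
            ((∑ u : Fin n, (F u).length : ℕ) : ℝ) ≤
              (n : ℝ) ^ 2 / 2 * Real.logb 2 n * (1 + ε n) := by
  obtain ⟨c, hc⟩ := CompactRouting.exists_shortestPathRouting
  refine ⟨_, CompactRouting.tendsto_routing_overhead, ?_⟩
  filter_upwards [CompactRouting.eventually_not_atypical hδ,
    CompactRouting.eventually_table_length_le c] with n hn hlen G hG π
  obtain ⟨hdeg, hM⟩ := CompactRouting.atypical_eq_false_iff.1 (hn G hG)
  obtain ⟨F, hF, hle⟩ := hc n (Nat.log 2 n + 1) (2 * Nat.log 2 (Nat.log 2 n) + 2) _ G π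
    (Nat.lt_pow_succ_log_self (by norm_num) n).le (by
      rw [show 2 * Nat.log 2 (Nat.log 2 n) + 2 = (Nat.log 2 (Nat.log 2 n) + 1) * 2 by ring, pow_mul]
      exact Nat.pow_le_pow_left (Nat.lt_pow_succ_log_self (by norm_num) _).le 2) hM
  have hF' := fun u : Fin n => hlen _ _ (hdeg u u.2) (hle u)
  refine ⟨F, hF, hF', ?_⟩
  rw [Nat.cast_sum]
  refine (Finset.sum_le_sum fun u _ => hF' u).trans (le_of_eq ?_)
  rw [Finset.sum_const, Finset.card_univ, Fintype.card_fin, nsmul_eq_mul]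
  ring
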